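/- Let $G$ be a group (finite or infinite). Then there exist infinitely many pairwise non-isomorphic simple undirected graphs $\Delta$, not necessarily finite, such that every vertex of $\Delta$ has valency at least $3$ (infinite valencies being allowed) and the automorphism group $\mathrm{Aut}(\Delta)$ is isomorphic to $G$. -/

import Mathlib

universe u

/-! The apex is the only vertex of finite valency, so it is fixed and its valency separates the
graphs. Adjacency to the apex then singles out the hubs, and adjacency to hubs the rails. The rails
see the well-order of the layers, which is rigid, so rails, hubs and layers are all fixed
(`apply_rail_eq`, `apply_hub_eq`, `apply_cell_eq`). The matchings between layers force a single
permutation of `G` commuting with all right multiplications, that is, a left translation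
(`exists_apply_cell_eq_mul`). -/

/-- Vertices of the graph attached to a group `G` and an index type `K`: an apex, `m` hubs, one rail
vertex for each index, and a copy of `G` for each index. -/
inductive LayeredVertex (G K : Type u) (m : ℕ) : Type u
  | apex : LayeredVertex G K m
  | hub (j : Fin m) : LayeredVertex G K m
  | rail (k : K) : LayeredVertex G K m
  | cell (g : G) (k : K) : LayeredVertex G K m

namespace LayeredVertex

variable {G K : Type u} {m n : ℕ}

/-- Adjacency of cells: the layer `b` is joined to every layer `k` by the matching
`g ↦ g * v k`, and any two other layers are joined by the identity matching. -/
def CellAdj [Group G] (b : K) (v : K → G) (g : G) (k : K) (h : G) (l : K) : Prop :=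
  k ≠ l ∧ ((k ≠ b ∧ l ≠ b ∧ g = h) ∨ (k = b ∧ h = g * v l) ∨ (l = b ∧ g = h * v k))

/-- The adjacency relation. The apex is joined to the hubs, the hub `j` to all rail vertices but
`e j`, any two rail vertices to each other, and the rail vertex `i` to the layers `k ≥ i`. -/
def Adj [Group G] [LinearOrder K] (b : K) (v : K → G) (e : Fin m → K) :
    LayeredVertex G K m → LayeredVertex G K m → Prop
  | apex, hub _ => True
  | hub _, apex => True
  | hub j, rail k => k ≠ e j
  | rail k, hub j => k ≠ e j
  | rail k, rail l => k ≠ l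
  | rail i, cell _ k => i ≤ k
  | cell _ k, rail i => i ≤ k
  | cell g k, cell h l => CellAdj b v g k h l
  | _, _ => False

/-- The graph on `LayeredVertex G K m` with adjacency `LayeredVertex.Adj`. -/
def graph [Group G] [LinearOrder K] (b : K) (v : K → G) (e : Fin m → K) :
    SimpleGraph (LayeredVertex G K m) where
  Adj := Adj b v e
  symm := ⟨by
    rintro (_ | j | k | ⟨g, k⟩) (_ | j' | k' | ⟨g', k'⟩) h <;> simp_all [Adj, CellAdj] <;> tauto⟩
  loopless := ⟨by
    rintro (_ | j | k | ⟨g, k⟩) h <;> simp_all [Adj, CellAdj]⟩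

section Neighbors

variable [Group G] [LinearOrder K] (b : K) (v : K → G) (e : Fin m → K)

theorem neighborSet_apex : (graph b v e).neighborSet apex = Set.range hub := by
  ext (_ | j | k | ⟨g, k⟩) <;> simp [graph, Adj]

theorem encard_neighborSet_apex : ((graph b v e).neighborSet apex).encard = m := by
  rw [neighborSet_apex, ← Set.image_univ,
    Function.Injective.encard_image (fun _ _ h => by simpa using h)]
  simp

theorem infinite_neighborSet [Infinite K] {w : LayeredVertex G K m} (hw : w ≠ apex) :
    ((graph b v e).neighborSet w).Infinite := by
  have key (s : Set K) (hs : s.Finite) (p : K → LayeredVertex G K m)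
      (hp : Function.Injective p) (h : ∀ k ∉ s, (graph b v e).Adj w (p k)) :
      ((graph b v e).neighborSet w).Infinite := by
    refine (hs.infinite_compl.image hp.injOn).mono ?_
    rintro _ ⟨k, hk, rfl⟩
    exact h k hk
  rcases w with _ | j | k | ⟨g, k⟩
  · exact absurd rfl hw
  · exact key {e j} (Set.finite_singleton _) rail (fun _ _ h => by simpa using h)
      (fun k hk => by simpa [graph, Adj] using hk)
  · exact key {k} (Set.finite_singleton _) rail (fun _ _ h => by simpa using h)
      (fun l hl => by simpa [graph, Adj, eq_comm] using hl)
  · by_cases hk : k = b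
    · refine key {b} (Set.finite_singleton _) (fun l => cell (g * v l) l)
        (fun _ _ h => by simp at h; exact h.2) (fun l hl => ?_)
      simp only [Set.mem_singleton_iff] at hl
      exact ⟨fun h => hl (h.symm.trans hk), Or.inr (Or.inl ⟨hk, rfl⟩)⟩
    · refine key {b, k} (Set.toFinite _) (fun l => cell g l)
        (fun _ _ h => by simpa using h) (fun l hl => ?_)
      simp only [Set.mem_insert_iff, Set.mem_singleton_iff, not_or] at hl
      exact ⟨fun h => hl.2 h.symm, Or.inl ⟨hk, hl.1, rfl⟩⟩

theorem three_le_encard_neighborSet [Infinite K] (hm : 3 ≤ m) (w : LayeredVertex G K m) :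
    3 ≤ ((graph b v e).neighborSet w).encard := by
  by_cases hw : w = apex
  · subst hw
    rw [encard_neighborSet_apex]
    exact_mod_cast hm
  · rw [(infinite_neighborSet b v e hw).encard_eq]
    exact le_top

end Neighbors

theorem encard_neighborSet_iso {V W : Type*} {Γ : SimpleGraph V} {Δ : SimpleGraph W}
    (σ : Γ ≃g Δ) (w : V) : (Δ.neighborSet (σ w)).encard = (Γ.neighborSet w).encard :=
  (Set.encard_congr (σ.mapNeighborSet w)).symm

section Iso

variable [Group G] [LinearOrder K] [Infinite K] {b : K} {v : K → G}

theorem iso_apex {e : Fin m → K} {e' : Fin n → K} (σ : graph b v e ≃g graph b v e') :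
    σ apex = apex := by
  by_contra h
  have h1 := (infinite_neighborSet b v e' h).encard_eq
  rw [encard_neighborSet_iso, encard_neighborSet_apex] at h1
  exact ENat.natCast_ne_top m h1

theorem eq_of_iso {e : Fin m → K} {e' : Fin n → K} (σ : graph b v e ≃g graph b v e') : m = n := by
  have h := encard_neighborSet_iso σ apex
  rw [iso_apex, encard_neighborSet_apex, encard_neighborSet_apex] at h
  exact_mod_cast h.symm

end Iso

section Automorphism

variable [Group G] [LinearOrder K] {b : K} {v : K → G} {e : Fin m → K}

theorem eq_hub_iff (w : LayeredVertex G K m) :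
    (∃ j, w = hub j) ↔ (graph b v e).Adj apex w := by
  rcases w with _ | j | k | ⟨g, k⟩ <;> simp [graph, Adj]

/-- Since `e` is injective, a rail misses at most one hub, so two hubs suffice to reach every rail.
-/
theorem eq_rail_iff (he : Function.Injective e) (hm : 2 ≤ m) (w : LayeredVertex G K m) :
    (∃ k, w = rail k) ↔
      w ≠ apex ∧ ∃ u, (graph b v e).Adj apex u ∧ (graph b v e).Adj u w := by
  constructor
  · rintro ⟨k, rfl⟩
    refine ⟨by simp, ?_⟩
    by_cases h : k = e ⟨0, by omega⟩
    · refine ⟨hub ⟨1, by omega⟩, trivial, fun h' => ?_⟩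
      simpa using he (h.symm.trans h')
    · exact ⟨hub ⟨0, by omega⟩, trivial, h⟩
  · rintro ⟨hw, u, hu, huw⟩
    obtain ⟨j, rfl⟩ := (eq_hub_iff u).2 hu
    rcases w with _ | j | k | ⟨g, k⟩
    · exact absurd rfl hw
    · exact huw.elim
    · exact ⟨k, rfl⟩
    · exact huw.elim

variable [Infinite K] (σ : graph b v e ≃g graph b v e)

theorem apply_hub (j : Fin m) : ∃ j', σ (hub j) = hub j' := by
  rw [eq_hub_iff (b := b) (v := v) (e := e), ← iso_apex σ, σ.map_adj_iff]
  exact trivial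

theorem apply_rail (he : Function.Injective e) (hm : 2 ≤ m) (k : K) :
    ∃ l, σ (rail k) = rail l := by
  obtain ⟨h, u, hu, huk⟩ := (eq_rail_iff (b := b) (v := v) he hm (rail k)).1 ⟨k, rfl⟩
  refine (eq_rail_iff (b := b) (v := v) he hm _).2 ⟨fun h' => ?_, σ u, ?_, σ.map_adj_iff.2 huk⟩
  · exact h (σ.injective (h'.trans (iso_apex σ).symm))
  · rw [← iso_apex σ]
    exact σ.map_adj_iff.2 hu

theorem apply_cell (he : Function.Injective e) (hm : 2 ≤ m) (g : G) (k : K) :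
    ∃ h l, σ (cell g k) = cell h l := by
  have key {w} (h : σ (cell g k) = w) : cell g k = σ.symm w := by simp [← h]
  rcases h : σ (cell g k) with _ | j | l | ⟨g', l⟩
  · simpa [iso_apex] using key h
  · obtain ⟨j', hj⟩ := apply_hub σ.symm j
    simpa [hj] using key h
  · obtain ⟨j', hj⟩ := apply_rail σ.symm he hm l
    simpa [hj] using key h
  · exact ⟨g', l, rfl⟩

/-- The order is visible in the graph: for `i ≤ j`, every cell adjacent to rail `j` is adjacent to
rail `i`. -/
theorem exists_strictMono_rail (he : Function.Injective e) (hm : 2 ≤ m) :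
    ∃ α : K → K, StrictMono α ∧ ∀ k, σ (rail k) = rail (α k) := by
  choose α hα using apply_rail σ he hm
  have hinj : Function.Injective α := fun i j h => by
    have : rail i = rail j := σ.injective (by rw [hα, hα, h])
    simpa using this
  refine ⟨α, Monotone.strictMono_of_injective (fun i j hij => ?_) hinj, hα⟩
  -- The test cell is pulled back from layer `α j`, where adjacency to rail `α i` means exactly `α i
  -- ≤ α j`.
  obtain ⟨g, k, hgk⟩ := apply_cell σ.symm he hm 1 (α j)
  have hσ : σ (cell g k) = cell 1 (α j) := by rw [← hgk]; simp
  have hj : (graph b v e).Adj (σ (rail j)) (σ (cell g k)) := by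
    rw [hα, hσ]
    exact le_refl (α j)
  have hjk : j ≤ k := σ.map_adj_iff.1 hj
  have hi : (graph b v e).Adj (σ (rail i)) (σ (cell g k)) :=
    σ.map_adj_iff.2 (show i ≤ k from hij.trans hjk)
  rw [hα, hσ] at hi
  exact hi

variable [WellFoundedLT K]

/-- A strictly monotone self-map of a well-order never decreases a point; this applies to both `σ`
and its inverse. -/
theorem apply_rail_eq (he : Function.Injective e) (hm : 2 ≤ m) (k : K) :
    σ (rail k) = rail k := by
  obtain ⟨α, hα, hσ⟩ := exists_strictMono_rail σ he hm
  obtain ⟨β, hβ, hτ⟩ := exists_strictMono_rail σ.symm he hm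
  have h : β (α k) = k := by
    have : (rail (β (α k)) : LayeredVertex G K m) = rail k := by rw [← hτ, ← hσ]; simp
    simpa using this
  rw [hσ, le_antisymm (hβ.le_apply.trans_eq h) hα.le_apply]

theorem apply_hub_eq (he : Function.Injective e) (hm : 2 ≤ m) (j : Fin m) :
    σ (hub j) = hub j := by
  obtain ⟨j', hj⟩ := apply_hub σ j
  have h : (graph b v e).Adj (σ (hub j)) (σ (rail (e j))) ↔
      (graph b v e).Adj (hub j) (rail (e j)) := σ.map_adj_iff
  rw [hj, apply_rail_eq σ he hm] at h
  have h' : e j = e j' := by simpa [graph, Adj] using h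
  rw [hj, he h']

theorem apply_cell_eq (he : Function.Injective e) (hm : 2 ≤ m) (g : G) (k : K) :
    ∃ h, σ (cell g k) = cell h k := by
  obtain ⟨h, l, hl⟩ := apply_cell σ he hm g k
  have key (i : K) : i ≤ l ↔ i ≤ k := by
    have : (graph b v e).Adj (σ (rail i)) (σ (cell g k)) ↔
      (graph b v e).Adj (rail i) (cell g k) := σ.map_adj_iff
    rwa [apply_rail_eq σ he hm, hl] at this
  exact ⟨h, by rw [hl, le_antisymm ((key l).1 le_rfl) ((key k).2 le_rfl)]⟩

theorem exists_apply_cell_eq_mul (he : Function.Injective e) (hm : 2 ≤ m)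
    (hv : ∀ c, ∃ k, k ≠ b ∧ v k = c) : ∃ c, ∀ g k, σ (cell g k) = cell (c * g) k := by
  choose φ hφ using apply_cell_eq σ he hm
  have hadj {g k h l} (H : CellAdj b v g k h l) : CellAdj b v (φ g k) k (φ h l) l := by
    have : (graph b v e).Adj (σ (cell g k)) (σ (cell h l)) := σ.map_adj_iff.2 H
    rwa [hφ, hφ] at this
  have h_id (g k l) (hk : k ≠ b) (hl : l ≠ b) : φ g k = φ g l := by
    by_cases hkl : k = l
    · rw [hkl]
    · simpa [hk, hl] using (hadj (g := g) ⟨hkl, Or.inl ⟨hk, hl, rfl⟩⟩).2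
  have h_mul (g l) (hl : l ≠ b) : φ (g * v l) l = φ g b * v l := by
    simpa [hl] using (hadj (g := g) ⟨hl.symm, Or.inr (Or.inl ⟨rfl, rfl⟩)⟩).2
  -- A layer labelled `1` is matched identically with the base, so the base carries the same
  -- permutation as the other layers.
  obtain ⟨k₁, hk₁, hv₁⟩ := hv 1
  have h_base (g) : φ g k₁ = φ g b := by simpa [hv₁] using h_mul g k₁ hk₁
  have h_all (g k) : φ g k = φ g b := by
    by_cases hk : k = b
    · rw [hk]
    · rw [h_id g k k₁ hk hk₁, h_base]
  refine ⟨φ 1 b, fun g k => ?_⟩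
  obtain ⟨l, hl, rfl⟩ := hv g
  have := h_mul 1 l hl
  rw [one_mul, h_all] at this
  rw [hφ, h_all, this]

end Automorphism

section Translation

variable [Group G]

/-- Left translation of the cells, fixing all other vertices. -/
def translate (c : G) : LayeredVertex G K m → LayeredVertex G K m
  | cell g k => cell (c * g) k
  | w => w

theorem translate_mul (c d : G) (w : LayeredVertex G K m) :
    translate (c * d) w = translate c (translate d w) := by
  rcases w with _ | j | k | ⟨g, k⟩ <;> simp [translate, mul_assoc]

theorem translate_one (w : LayeredVertex G K m) : translate 1 w = w := by
  rcases w with _ | j | k | ⟨g, k⟩ <;> simp [translate]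

variable [LinearOrder K] (b : K) (v : K → G) (e : Fin m → K)

/-- Left translation as a homomorphism from `G` to the automorphism group of the graph. -/
def translateHom : G →* (graph b v e ≃g graph b v e) where
  toFun c :=
    { toFun := translate c
      invFun := translate c⁻¹
      left_inv := fun w => by rw [← translate_mul, inv_mul_cancel, translate_one]
      right_inv := fun w => by rw [← translate_mul, mul_inv_cancel, translate_one]
      map_rel_iff' := by
        rintro (_ | j | k | ⟨g, k⟩) (_ | j' | k' | ⟨g', k'⟩) <;>
          simp [graph, Adj, CellAdj, translate, mul_assoc] }
  map_one' := by
    ext w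
    exact translate_one w
  map_mul' c d := by
    ext w
    exact translate_mul c d w

theorem translateHom_bijective [Infinite K] [WellFoundedLT K] (he : Function.Injective e)
    (hm : 2 ≤ m) (hv : ∀ c, ∃ k, k ≠ b ∧ v k = c) :
    Function.Bijective (translateHom b v e) := by
  constructor
  · intro c d h
    have : cell (c * 1) b = cell (d * 1) b :=
      congrArg (fun σ : graph b v e ≃g graph b v e => σ (cell 1 b)) h
    simpa using this
  · intro σ
    obtain ⟨c, hc⟩ := exists_apply_cell_eq_mul σ he hm hv
    refine ⟨c, ?_⟩
    ext w
    rcases w with _ | j | k | ⟨g, k⟩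
    · exact (iso_apex σ).symm
    · exact (apply_hub_eq σ he hm j).symm
    · exact (apply_rail_eq σ he hm k).symm
    · exact (hc g k).symm

end Translation

end LayeredVertex

open LayeredVertex in
/-- Every group `G` is the automorphism group of infinitely many pairwise non-isomorphic simple
undirected graphs (finite or infinite) all of whose vertices have valency at least `3`.
The valency is taken in `ℕ∞`, so infinite valencies are allowed. -/
theorem mainTheorem5 (G : Type u) [Group G] :
    ∃ (V : ℕ → Type u) (Δ : ∀ i : ℕ, SimpleGraph (V i)),
      (∀ i j : ℕ, i ≠ j → IsEmpty (Δ i ≃g Δ j)) ∧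
      (∀ (i : ℕ) (v : V i), 3 ≤ ((Δ i).neighborSet v).encard) ∧
      (∀ i : ℕ, Nonempty ((Δ i ≃g Δ i) ≃* G)) := by
  -- The factor `ℕ` makes the index type infinite and leaves, for each group element, a layer off
  -- the base with that label.
  obtain ⟨_, _⟩ := exists_wellFoundedLT (ℕ × G)
  have he (i : ℕ) : Function.Injective (fun j : Fin (i + 3) => ((j : ℕ), (1 : G))) :=
    fun j l h => Fin.ext (by simpa using h)
  refine ⟨fun i => LayeredVertex G (ℕ × G) (i + 3),
    fun i => graph (0, 1) Prod.snd (fun j => ((j : ℕ), 1)), fun i j hij => ⟨fun σ => ?_⟩,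
    fun i w => three_le_encard_neighborSet _ _ _ (by omega) w, fun i => ⟨?_⟩⟩
  · exact hij (by simpa using eq_of_iso σ)
  · exact (MulEquiv.ofBijective _ (translateHom_bijective (0, 1) Prod.snd _ (he i) (by omega)
      (fun c => ⟨(1, c), by simp, rfl⟩))).symm
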